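/- Let $X$ be a real-valued random variable and let $n\ge 2$ be an integer such that $\mathsf{E}|X-\mathsf{E}X|^n<\infty$. Then $\mathsf{E}|X|^n<\infty$, so that the $n$-th cumulant $$\kappa_n(X)=\sum_{\pi\in\mathcal P(n)}(-1)^{|\pi|-1}(|\pi|-1)!\prod_{B\in\pi}\mathsf{E}\bigl[X^{|B|}\bigr]$$ is well defined, where $\mathcal P(n)$ is the set of all partitions of $\{1,\dots,n\}$ into nonempty blocks and $|\pi|$ is the number of blocks of $\pi$, and $$|\kappa_n(X)|\le C_{\mathrm{cen}}(n)\,\mathsf{E}|X-\mathsf{E}X|^n,\qquad C_{\mathrm{cen}}(n):=\sum_{\substack{\pi\in\mathcal P(n)\\ |B|\ge 2\ \forall B\in\pi}}(|\pi|-1)!.$$ Moreover, the equation $e^{\rho}=2+\rho$ has a unique positive solution $\rho_{\mathrm{cen}}$, it satisfies $|\rho_{\mathrm{cen}}-1.146|<0.0005$, and $$C_{\mathrm{cen}}(n)\sim\frac{(n-1)!}{\rho_{\mathrm{cen}}^{\,n}}\qquad(n\to\infty).$$ -/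

import Mathlib

open scoped Nat

/-- The `n`-th cumulant of a real random variable, defined by the moment-cumulant formula
`κ_n(X) = ∑_π (-1)^(|π|-1) (|π|-1)! ∏_{B ∈ π} E[X^|B|]`, where `π` runs over the partitions of an
`n`-element set into nonempty blocks (`n ≥ 1`, so that `|π| ≥ 1`). -/
noncomputable def cumulant {Ω : Type*} [MeasurableSpace Ω] (X : Ω → ℝ)
    (P : MeasureTheory.Measure Ω) (n : ℕ) : ℝ :=
  ∑ π : Finpartition (Finset.univ : Finset (Fin n)),
    (-1 : ℝ) ^ (π.parts.card - 1) * ((π.parts.card - 1)! : ℝ) *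
      ∏ B ∈ π.parts, ProbabilityTheory.moment X B.card P

/-- The sum of `(|π|-1)!` over the partitions `π` of an `n`-element set all of whose blocks have
at least two elements. -/
def centralCoeff (n : ℕ) : ℕ :=
  ∑ π : Finpartition (Finset.univ : Finset (Fin n)) with ∀ B ∈ π.parts, 2 ≤ B.card,
    (π.parts.card - 1)!

/-! By Faà di Bruno, the partition sum defining a cumulant of order `n + 1` is `n !` times the
`n`-th coefficient of the logarithmic derivative `U'/U` of the moment series. Replacing `X` by `X +
c` multiplies `U` by `exp (cz)`, which adds the constant `c` to `U'/U`, so only the first cumulant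
changes and `X` may be centred. Partitions with a singleton then contribute zero, and by Lyapunov
each remaining product of moments is at most `E|X|^n`.

The same formula with `U = 2 + z - exp z`, whose first derivative at 0 vanishes and whose higher
ones are `-1`, makes `-U'/U` generate `centralCoeff (n + 1) / n !`. In the closed disc of radius `ρ`
the only zero of `U` is `ρ`, and it is simple. Hence `G = (z - ρ) U'/U` is holomorphic on a larger
disc with `G ρ = 1`, and the normalised coefficients are the partial sums of the Taylor series of
`G` at `ρ`. -/

/-! ### Set partitions as ordered partitions -/

namespace OrderedFinpartition

variable {n : ℕ}

/-- The `m`-th part of an ordered finpartition, as a finset. -/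
def block (c : OrderedFinpartition n) (m : Fin c.length) : Finset (Fin n) :=
  Finset.univ.image (c.emb m)

theorem card_block (c : OrderedFinpartition n) (m : Fin c.length) :
    (c.block m).card = c.partSize m := by
  rw [block, Finset.card_image_of_injective _ (c.emb_strictMono m).injective, Finset.card_univ,
    Fintype.card_fin]

theorem block_nonempty (c : OrderedFinpartition n) (m : Fin c.length) : (c.block m).Nonempty := by
  rw [← Finset.card_pos, card_block]
  exact c.partSize_pos m

theorem disjoint_block (c : OrderedFinpartition n) {i j : Fin c.length} (h : i ≠ j) :
    Disjoint (c.block i) (c.block j) := by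
  rw [Finset.disjoint_left]
  intro x hx hy
  simp only [block, Finset.mem_image, Finset.mem_univ, true_and] at hx hy
  obtain ⟨a, rfl⟩ := hx
  obtain ⟨b, hb⟩ := hy
  exact c.emb_ne_emb_of_ne h hb.symm

theorem block_injective (c : OrderedFinpartition n) : Function.Injective c.block := by
  intro i j hij
  by_contra h
  have := c.disjoint_block h
  rw [hij, disjoint_self] at this
  exact (c.block_nonempty j).ne_empty this

/-- The finpartition underlying an ordered finpartition. -/
def toFinpartition (c : OrderedFinpartition n) :
    Finpartition (Finset.univ : Finset (Fin n)) where
  parts := Finset.univ.image c.block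
  supIndep := by
    rw [Finset.supIndep_iff_pairwiseDisjoint]
    intro A hA B hB hAB
    simp only [Finset.coe_image, Finset.coe_univ, Set.image_univ, Set.mem_range] at hA hB
    obtain ⟨i, rfl⟩ := hA
    obtain ⟨j, rfl⟩ := hB
    exact c.disjoint_block fun h => hAB (by rw [h])
  sup_parts := by
    ext x
    obtain ⟨m, r, hr⟩ := c.cover x
    simp only [Finset.mem_sup, Finset.mem_image, Finset.mem_univ, true_and, id, iff_true]
    exact ⟨_, ⟨m, rfl⟩, Finset.mem_image.2 ⟨r, Finset.mem_univ _, hr⟩⟩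
  bot_notMem := by
    simp only [Finset.mem_image, Finset.mem_univ, true_and, not_exists]
    intro m
    exact (c.block_nonempty m).ne_empty

theorem card_parts_toFinpartition (c : OrderedFinpartition n) :
    c.toFinpartition.parts.card = c.length := by
  simp [toFinpartition, Finset.card_image_of_injective _ c.block_injective]

theorem prod_parts_toFinpartition {R : Type*} [CommMonoid R] (c : OrderedFinpartition n)
    (f : ℕ → R) : ∏ B ∈ c.toFinpartition.parts, f B.card = ∏ m, f (c.partSize m) := by
  simp [toFinpartition, Finset.prod_image c.block_injective.injOn, card_block]

/-- The blocks of an ordered partition are listed by increasing maximum, so the unordered set of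
blocks determines the list: strictly monotone maps with the same range coincide. -/
theorem toFinpartition_injective :
    Function.Injective (toFinpartition : OrderedFinpartition n → _) := by
  intro c d h
  have hlen : c.length = d.length := by
    rw [← card_parts_toFinpartition, h, card_parts_toFinpartition]
  have hparts : ∀ A, (∃ m, c.block m = A) ↔ ∃ m, d.block m = A := by
    intro A
    have := congrArg (fun π => A ∈ π.parts) h
    simpa [toFinpartition] using this
  have hsub : ∀ (c d : OrderedFinpartition n)
      (_ : ∀ A, (∃ m, c.block m = A) → ∃ m, d.block m = A),
      Set.range (fun m ↦ c.emb m ⟨c.partSize m - 1, Nat.sub_one_lt_of_lt (c.partSize_pos m)⟩) ⊆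
      Set.range (fun m ↦ d.emb m ⟨d.partSize m - 1, Nat.sub_one_lt_of_lt (d.partSize_pos m)⟩) := by
    rintro c d hp _ ⟨m, rfl⟩
    obtain ⟨m', hm'⟩ := hp _ ⟨m, rfl⟩
    refine ⟨m', ?_⟩
    have key : ∀ (c d : OrderedFinpartition n) (m m') (_ : d.block m' = c.block m),
        d.emb m' ⟨d.partSize m' - 1, Nat.sub_one_lt_of_lt (d.partSize_pos m')⟩ ≤
        c.emb m ⟨c.partSize m - 1, Nat.sub_one_lt_of_lt (c.partSize_pos m)⟩ := by
      intro c d m m' hb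
      have : d.emb m' ⟨d.partSize m' - 1, Nat.sub_one_lt_of_lt (d.partSize_pos m')⟩
          ∈ c.block m := by
        rw [← hb]; exact Finset.mem_image_of_mem _ (Finset.mem_univ _)
      obtain ⟨r, -, hr⟩ := Finset.mem_image.1 this
      rw [← hr]
      apply (c.emb_strictMono m).monotone
      rw [Fin.le_def]
      exact Nat.le_sub_one_of_lt r.2
    exact le_antisymm (key _ _ _ _ hm') (key _ _ _ _ hm'.symm)
  have hrange := (hsub c d fun A => (hparts A).1).antisymm (hsub d c fun A => (hparts A).2)
  have hblock : ∀ (i : Fin c.length) (j : Fin d.length),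
      c.emb i ⟨c.partSize i - 1, Nat.sub_one_lt_of_lt (c.partSize_pos i)⟩ =
      d.emb j ⟨d.partSize j - 1, Nat.sub_one_lt_of_lt (d.partSize_pos j)⟩ →
      c.block i = d.block j := by
    intro i j hij
    obtain ⟨i', hi'⟩ := (hparts (d.block j)).2 ⟨j, rfl⟩
    rw [← hi']
    congr 1
    by_contra hne
    refine Finset.disjoint_left.1 (c.disjoint_block hne) (Finset.mem_image_of_mem (c.emb i)
      (Finset.mem_univ ⟨c.partSize i - 1, Nat.sub_one_lt_of_lt (c.partSize_pos i)⟩)) ?_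
    rw [hi', hij]
    exact Finset.mem_image_of_mem (d.emb j) (Finset.mem_univ _)
  obtain ⟨k, s, s_pos, e, e_mono, p_mono, disj, cov⟩ := c
  obtain ⟨k', s', s_pos', e', e_mono', p_mono', disj', cov'⟩ := d
  dsimp only at hlen
  subst hlen
  have hmax := (StrictMono.range_inj p_mono p_mono').1 hrange
  have hblock' : ∀ i, Finset.univ.image (e i) = Finset.univ.image (e' i) :=
    fun i => hblock i i (congrFun hmax i)
  have hs : s = s' := by
    funext i
    have := congrArg Finset.card (hblock' i)
    simpa [Finset.card_image_of_injective _ (e_mono i).injective,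
      Finset.card_image_of_injective _ (e_mono' i).injective] using this
  subst hs
  have he : e = e' := by
    funext i
    refine (StrictMono.range_inj (e_mono i) (e_mono' i)).1 ?_
    have := congrArg (fun A : Finset (Fin n) => (A : Set (Fin n))) (hblock' i)
    simpa using this
  subst he
  rfl

theorem toFinpartition_surjective :
    Function.Surjective (toFinpartition : OrderedFinpartition n → _) := by
  intro π
  -- `S` is the set of block maxima; enumerating it increasingly gives the required order of the
  -- blocks.
  set S : Finset (Fin n) := Finset.univ.filter fun x => ∀ y ∈ π.part x, y ≤ x with hS
  have hmem : ∀ x, x ∈ π.part x := fun x => π.mem_part (Finset.mem_univ x)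
  have hne : ∀ x, (π.part x).Nonempty := fun x => ⟨x, hmem x⟩
  have hpart : ∀ x, ∀ y ∈ π.part x, π.part y = π.part x := fun x y hy =>
    π.part_eq_of_mem (π.part_mem.2 (Finset.mem_univ x)) hy
  let T := S.orderEmbOfFin (k := S.card) rfl
  have hT : ∀ m, T m ∈ S := fun m => S.orderEmbOfFin_mem rfl m
  have hTmax : ∀ m, ∀ y ∈ π.part (T m), y ≤ T m := fun m => (Finset.mem_filter.1 (hT m)).2
  have hTinj : ∀ i j, π.part (T i) = π.part (T j) → i = j := by
    intro i j hij
    apply T.injective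
    exact le_antisymm (hTmax j _ (hij ▸ hmem _)) (hTmax i _ (hij ▸ hmem _))
  have hrange : ∀ m, Set.range ((π.part (T m)).orderEmbOfFin (k := (π.part (T m)).card) rfl) =
      (π.part (T m) : Set (Fin n)) := fun m => Finset.range_orderEmbOfFin _ _
  have hsurj : ∀ x, ∃ m, π.part (T m) = π.part x := by
    intro x
    have h1 := (π.part x).max'_mem (hne x)
    have h2 : (π.part x).max' (hne x) ∈ S := by
      rw [hS, Finset.mem_filter]
      refine ⟨Finset.mem_univ _, fun y hy => ?_⟩
      rw [hpart x _ h1] at hy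
      exact Finset.le_max' _ _ hy
    have h3 : (π.part x).max' (hne x) ∈ Set.range T := by
      rw [Finset.range_orderEmbOfFin]; exact h2
    obtain ⟨m, hm⟩ := h3
    exact ⟨m, by rw [hm]; exact hpart x _ h1⟩
  refine ⟨{ length := S.card
            partSize := fun m => (π.part (T m)).card
            partSize_pos := fun m => (hne _).card_pos
            emb := fun m => (π.part (T m)).orderEmbOfFin rfl
            emb_strictMono := fun m => OrderEmbedding.strictMono _
            parts_strictMono := ?_
            disjoint := ?_
            cover := ?_ }, ?_⟩
  · have : (fun m : Fin S.card => (π.part (T m)).orderEmbOfFin rfl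
        ⟨(π.part (T m)).card - 1, Nat.sub_one_lt_of_lt (hne _).card_pos⟩) = T := by
      funext m
      rw [Finset.orderEmbOfFin_last rfl (hne _).card_pos]
      exact le_antisymm (Finset.max'_le _ _ _ (hTmax m)) (Finset.le_max' _ _ (hmem _))
    rw [this]
    exact T.strictMono
  · intro i _ j _ hij
    simp only [Function.onFun, hrange, Finset.disjoint_coe]
    exact π.disjoint (π.part_mem.2 (Finset.mem_univ _)) (π.part_mem.2 (Finset.mem_univ _))
      fun h => hij (hTinj i j h)
  · intro x
    obtain ⟨m, hm⟩ := hsurj x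
    refine ⟨m, ?_⟩
    rw [hrange, hm]
    exact hmem x
  · apply Finpartition.ext
    ext A
    simp only [toFinpartition, block, Finset.image_orderEmbOfFin_univ, Finset.mem_image,
      Finset.mem_univ, true_and]
    constructor
    · rintro ⟨m, rfl⟩
      exact π.part_mem.2 (Finset.mem_univ _)
    · intro hA
      obtain ⟨x, hx⟩ := π.nonempty_of_mem_parts hA
      obtain ⟨m, hm⟩ := hsurj x
      exact ⟨m, by rw [hm]; exact π.part_eq_of_mem hA hx⟩

end OrderedFinpartition

/-- Sums over finpartitions of `Fin n` of a quantity depending only on the number and the sizes of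
the blocks can be computed with ordered finpartitions. -/
theorem sum_finpartition_eq_sum_orderedFinpartition {R : Type*} [CommSemiring R] (n : ℕ)
    (g f : ℕ → R) :
    ∑ π : Finpartition (Finset.univ : Finset (Fin n)),
      g π.parts.card * ∏ B ∈ π.parts, f B.card =
    ∑ c : OrderedFinpartition n, g c.length * ∏ m, f (c.partSize m) := by
  symm
  refine Fintype.sum_bijective OrderedFinpartition.toFinpartition
    ⟨OrderedFinpartition.toFinpartition_injective,
      OrderedFinpartition.toFinpartition_surjective⟩ _ _ fun c => ?_
  rw [c.card_parts_toFinpartition, c.prod_parts_toFinpartition]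

/-! ### Faà di Bruno's formula and logarithmic derivatives -/

/-- The Leibniz rule for a finite product. -/
theorem Derivation.map_finset_prod {A R ι : Type*} [CommRing A] [CommRing R] [Algebra A R]
    [DecidableEq ι] (D : Derivation A R R) (s : Finset ι) (f : ι → R) :
    D (∏ i ∈ s, f i) = ∑ i ∈ s, (∏ j ∈ s.erase i, f j) * D (f i) := by
  induction s using Finset.induction_on with
  | empty => simp
  | insert a s ha ih =>
    rw [Finset.prod_insert ha, D.leibniz, ih, Finset.sum_insert ha, Finset.erase_insert ha,
      smul_eq_mul, smul_eq_mul, Finset.mul_sum, add_comm]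
    congr 1
    refine Finset.sum_congr rfl fun i hi => ?_
    have hai : a ≠ i := fun h => ha (h ▸ hi)
    rw [Finset.erase_insert_of_ne hai, Finset.prod_insert (fun h => ha (Finset.mem_of_mem_erase h)),
      mul_assoc]

/-- The algebraic Faà di Bruno formula. -/
theorem Derivation.iterate_eq_sum_finpartition {A R : Type*} [CommRing A] [CommRing R]
    [Algebra A R] (D : Derivation A R R) (f g : ℕ → R) (hf : ∀ k, 1 ≤ k → D (f k) = f (k + 1))
    (hg : ∀ k, 1 ≤ k → D (g k) = g (k + 1) * f 1) (n : ℕ) :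
    D^[n] (g 1 * f 1) = ∑ π : Finpartition (Finset.univ : Finset (Fin (n + 1))),
      g π.parts.card * ∏ B ∈ π.parts, f B.card := by
  rw [sum_finpartition_eq_sum_orderedFinpartition]
  induction n with
  | zero =>
    simp only [Function.iterate_zero, id, Nat.reduceAdd, Fintype.sum_unique]
    change _ = g 1 * ∏ m : Fin 1, f 1
    simp
  | succ n ih =>
    -- A new element either forms its own block, matching the derivative of the factor `g`, or joins
    -- block `i`, matching the derivative of the `i`-th factor `f`.
    rw [Function.iterate_succ_apply', ih, map_sum,
      ← (OrderedFinpartition.extendEquiv (n + 1)).sum_comp, Fintype.sum_sigma]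
    refine Finset.sum_congr rfl fun c _ => ?_
    rw [Fintype.sum_option]
    change _ = g c.extendLeft.length * (∏ m, f (c.extendLeft.partSize m)) +
      ∑ i, g (c.extendMiddle i).length * ∏ m, f ((c.extendMiddle i).partSize m)
    have h1 : ∏ m, f (c.extendLeft.partSize m) = f 1 * ∏ m, f (c.partSize m) := by
      change ∏ m : Fin (c.length + 1), f (Fin.cons (α := fun _ => ℕ) 1 c.partSize m) = _
      rw [Fin.prod_univ_succ]
      simp
    have h2 : ∀ i, ∏ m, f ((c.extendMiddle i).partSize m) =
        (∏ j ∈ Finset.univ.erase i, f (c.partSize j)) * f (c.partSize i + 1) := by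
      intro i
      change ∏ m : Fin c.length, f (Function.update c.partSize i (c.partSize i + 1) m) = _
      rw [← Finset.prod_erase_mul _ _ (Finset.mem_univ i), Function.update_self]
      congr 1
      refine Finset.prod_congr rfl fun j hj => ?_
      rw [Function.update_of_ne (Finset.ne_of_mem_erase hj)]
    have h3 : D (∏ m, f (c.partSize m)) = ∑ i,
        (∏ j ∈ Finset.univ.erase i, f (c.partSize j)) * f (c.partSize i + 1) := by
      rw [D.map_finset_prod]
      refine Finset.sum_congr rfl fun i _ => ?_
      rw [hf _ (c.partSize_pos i)]
    rw [D.leibniz, h1, h3, hg _ (c.length_pos n.succ_pos)]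
    simp only [h2, OrderedFinpartition.extendLeft_length, OrderedFinpartition.extendMiddle_length,
      smul_eq_mul, Finset.mul_sum]
    ring

open PowerSeries in
/-- The sum over partitions which expresses the derivatives at the origin of the logarithm of a
power series with constant term `1`. -/
theorem PowerSeries.sum_finpartition_eq_logDeriv {K : Type*} [Field K] (U : K⟦X⟧)
    (hU : constantCoeff U = 1) (n : ℕ) :
    ∑ π : Finpartition (Finset.univ : Finset (Fin (n + 1))),
      ((-1 : K) ^ (π.parts.card - 1) * ((π.parts.card - 1)! : K)) *
        ∏ B ∈ π.parts, ((B.card)! * coeff B.card U : K) =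
    n ! * coeff n (U⁻¹ * d⁄dX K U) := by
  -- Here `g k` is the `k`-th derivative of the logarithm at `U`. Starting at `k = 1` avoids
  -- defining the logarithm of a power series.
  have key := Derivation.iterate_eq_sum_finpartition (d⁄dX K) (fun k => (d⁄dX K)^[k] U)
    (fun k => C ((-1 : K) ^ (k - 1) * ((k - 1)! : K)) * U⁻¹ ^ k)
    (fun k _ => (Function.iterate_succ_apply' _ _ _).symm) (by
      intro k hk
      obtain ⟨k, rfl⟩ := Nat.exists_eq_add_of_le' hk
      have h1 : C ((-1 : K) ^ (k + 1) * ((k + 1)! : K)) =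
          -(C ((-1 : K) ^ k * (k ! : K)) * (k + 1 : K⟦X⟧)) := by
        rw [Nat.factorial_succ, pow_succ]
        simp only [map_add, map_mul, map_neg, map_one, map_natCast, Nat.cast_mul, Nat.cast_add,
          Nat.cast_one]
        ring
      simp only [Nat.add_sub_cancel, Derivation.leibniz, derivative_C, smul_eq_mul,
        Function.iterate_one, derivative_pow, derivative_inv', h1]
      push_cast
      ring) n
  have h2 := congrArg (constantCoeff (R := K)) key
  rw [map_sum] at h2
  have h3 : ∀ k, constantCoeff ((d⁄dX K)^[k] U) = (k ! * coeff k U : K) := fun k => by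
    rw [constantCoeff_iterate_derivative]
  rw [constantCoeff_iterate_derivative] at h2
  simp only [map_mul, map_prod, map_pow, h3, constantCoeff_inv, hU, inv_one, one_pow, mul_one,
    constantCoeff_C] at h2
  rw [← h2]
  simp

-- The logarithmic derivative turns products into sums, and that of `exp (cX)` is `c`.
open PowerSeries in
theorem PowerSeries.logDeriv_exp_mul (M : ℝ⟦X⟧) (hM : constantCoeff M = 1) (c : ℝ) :
    (rescale c (exp ℝ) * M)⁻¹ * d⁄dX ℝ (rescale c (exp ℝ) * M) =
      C c + M⁻¹ * d⁄dX ℝ M := by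
  have hE : d⁄dX ℝ (rescale c (exp ℝ)) = C c * rescale c (exp ℝ) := by
    ext n
    simp only [coeff_derivative, coeff_rescale, coeff_exp, coeff_C_mul, Nat.factorial_succ]
    push_cast
    have : (n ! : ℝ) ≠ 0 := by positivity
    have : (n + 1 : ℝ) ≠ 0 := by positivity
    simp
    field_simp
    ring
  have hE0 : constantCoeff (rescale c (exp ℝ)) ≠ 0 := by
    simp [← coeff_zero_eq_constantCoeff_apply]
  have h1 := PowerSeries.inv_mul_cancel _ hE0
  have h2 := PowerSeries.inv_mul_cancel M (by rw [hM]; exact one_ne_zero)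
  rw [PowerSeries.mul_inv_rev, Derivation.leibniz, hE, smul_eq_mul, smul_eq_mul]
  linear_combination (M⁻¹ * d⁄dX ℝ M + C c * (M⁻¹ * M)) * h1 + C c * h2

/-! ### Translation invariance and the cumulant bound -/

section moments

open MeasureTheory ProbabilityTheory

variable {Ω : Type*} [MeasurableSpace Ω] {P : Measure Ω} [IsProbabilityMeasure P] {X : Ω → ℝ}

theorem memLp_of_integrable_abs_pow {P : Measure Ω} {n : ℕ} (hn : n ≠ 0) (hX : AEMeasurable X P)
    (h : Integrable (fun ω => |X ω| ^ n) P) : MemLp X n P := by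
  rw [← integrable_norm_rpow_iff hX.aestronglyMeasurable (by simpa using hn) (by simp)]
  simpa using h

theorem integrable_pow_of_memLp {n k : ℕ} (hX : MemLp X n P) (hk : k ≤ n) :
    Integrable (fun ω => X ω ^ k) P := by
  have h : MemLp X k P := hX.mono_exponent (by exact_mod_cast hk)
  have := h.integrable_norm_pow'
  refine (integrable_norm_iff (h.1.pow k)).1 ?_
  simpa using this

theorem moment_add_const {n k : ℕ} (hX : MemLp X n P) (hk : k ≤ n) (c : ℝ) :
    moment (fun ω => X ω + c) k P =
      ∑ j ∈ Finset.range (k + 1), moment X j P * c ^ (k - j) * k.choose j := by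
  have : (fun ω => X ω + c) ^ k =
      fun ω => ∑ j ∈ Finset.range (k + 1), X ω ^ j * c ^ (k - j) * k.choose j := by
    funext ω
    simp [add_pow]
  rw [moment_def, this, integral_finsetSum]
  · refine Finset.sum_congr rfl fun j _ => ?_
    rw [integral_mul_const, integral_mul_const, moment_def]
    rfl
  · intro j hj
    rw [Finset.mem_range] at hj
    exact ((integrable_pow_of_memLp hX (by omega)).mul_const _).mul_const _

theorem cumulant_congr {Ω' : Type*} [MeasurableSpace Ω'] {P' : Measure Ω'} {Y : Ω' → ℝ} {n : ℕ}
    {m : ℕ → ℝ} (h : ∀ k ≤ n, moment Y k P' = m k) :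
    cumulant Y P' n = ∑ π : Finpartition (Finset.univ : Finset (Fin n)),
      ((-1 : ℝ) ^ (π.parts.card - 1) * ((π.parts.card - 1)! : ℝ)) * ∏ B ∈ π.parts, m B.card := by
  refine Finset.sum_congr rfl fun π _ => ?_
  congr 1
  refine Finset.prod_congr rfl fun B _ => h _ ?_
  simpa using B.card_le_univ

open PowerSeries in
/-- Cumulants of order at least two are invariant under translation. -/
theorem cumulant_add_const {n : ℕ} (hn : 2 ≤ n) (hX : MemLp X n P) (c : ℝ) :
    cumulant (fun ω => X ω + c) P n = cumulant X P n := by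
  obtain ⟨n, rfl⟩ := Nat.exists_eq_add_of_le' (show 1 ≤ n by omega)
  -- Moments above the order of the cumulant may be default values of divergent integrals; their
  -- coefficients never enter.
  set M : ℝ⟦X⟧ := PowerSeries.mk fun k => moment X k P / k ! with hMdef
  have hM : constantCoeff M = 1 := by
    rw [← coeff_zero_eq_constantCoeff_apply, hMdef, coeff_mk]
    simp [moment_def]
  have hN : constantCoeff (rescale c (exp ℝ) * M) = 1 := by
    rw [map_mul, hM]
    simp [← coeff_zero_eq_constantCoeff_apply]
  have hcoeffM : ∀ k, moment X k P = k ! * coeff k M := by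
    intro k
    rw [hMdef, coeff_mk, mul_div_cancel₀ _ (by positivity)]
  rw [cumulant_congr (fun k _ => hcoeffM k),
    cumulant_congr (m := fun k => k ! * coeff k (rescale c (exp ℝ) * M)),
    sum_finpartition_eq_logDeriv _ hM, sum_finpartition_eq_logDeriv _ hN, logDeriv_exp_mul M hM c,
    map_add, coeff_C, if_neg (by omega), zero_add]
  intro k hk
  rw [moment_add_const hX hk, mul_comm (rescale c (exp ℝ)), coeff_mul,
    Finset.Nat.sum_antidiagonal_eq_sum_range_succ_mk, Finset.mul_sum]
  refine Finset.sum_congr rfl fun j hj => ?_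
  have hj' : j ≤ k := by simpa [Nat.lt_succ_iff] using hj
  rw [hMdef, coeff_mk, coeff_rescale, coeff_exp, Nat.cast_choose ℝ hj']
  simp
  field_simp

/-- Lyapunov's inequality for natural exponents. -/
theorem integral_abs_pow_le {n k : ℕ} (hX : MemLp X n P) (hk : k ≤ n) (hk0 : k ≠ 0) :
    ∫ ω, |X ω| ^ k ∂P ≤ ((∫ ω, |X ω| ^ n ∂P) ^ (1 / n : ℝ)) ^ k := by
  have hk' : (0 : ℝ) < k := by positivity
  have hn' : (0 : ℝ) < n := by
    have : (k : ℝ) ≤ n := by exact_mod_cast hk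
    linarith
  have hX' : MemLp (fun ω => |X ω|) n P := hX.abs
  have hpow : ∀ ω, (|X ω| ^ k) ^ (n / k : ℝ) = |X ω| ^ n := by
    intro ω
    rw [← Real.rpow_natCast, ← Real.rpow_mul (abs_nonneg _), mul_div_cancel₀ _ hk'.ne',
      Real.rpow_natCast]
  have h1 : (1 : ℝ) ≤ n / k := by
    rw [one_le_div hk']; exact_mod_cast hk
  -- Jensen's inequality for `t ↦ t ^ (n / k)`.
  have hJ := (convexOn_rpow h1).map_integral_le (μ := P) (f := fun ω => |X ω| ^ k)
    (Real.continuous_rpow_const (by positivity)).continuousOn isClosed_Ici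
    (Filter.Eventually.of_forall fun ω => by simp)
    (integrable_pow_of_memLp hX' hk)
    (by simpa only [Function.comp_def, hpow] using integrable_pow_of_memLp hX' le_rfl)
  simp only [hpow] at hJ
  have hnn : 0 ≤ ∫ ω, |X ω| ^ k ∂P := integral_nonneg fun ω => by positivity
  have hnn' : 0 ≤ ∫ ω, |X ω| ^ n ∂P := integral_nonneg fun ω => by positivity
  calc ∫ ω, |X ω| ^ k ∂P = ((∫ ω, |X ω| ^ k ∂P) ^ (n / k : ℝ)) ^ (k / n : ℝ) := by
        rw [← Real.rpow_mul hnn, div_mul_div_cancel₀ hk'.ne', div_self hn'.ne', Real.rpow_one]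
    _ ≤ (∫ ω, |X ω| ^ n ∂P) ^ (k / n : ℝ) :=
        Real.rpow_le_rpow (by positivity) hJ (by positivity)
    _ = _ := by
        rw [← Real.rpow_natCast, ← Real.rpow_mul hnn', one_div_mul_eq_div]

/-- The cumulant bound for a centred random variable. -/
theorem abs_cumulant_le_of_integral_eq_zero {n : ℕ} (hn : 1 ≤ n) (hX : MemLp X n P)
    (h0 : ∫ ω, X ω ∂P = 0) :
    |cumulant X P n| ≤ (centralCoeff n : ℝ) * ∫ ω, |X ω| ^ n ∂P := by
  classical
  have hnn : 0 ≤ ∫ ω, |X ω| ^ n ∂P := integral_nonneg fun ω => by positivity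
  rw [cumulant, centralCoeff, Nat.cast_sum, Finset.sum_mul, Finset.sum_filter]
  refine (Finset.abs_sum_le_sum_abs _ _).trans (Finset.sum_le_sum fun π _ => ?_)
  rw [abs_mul, abs_mul, abs_pow, abs_neg, abs_one, one_pow, one_mul, Nat.abs_cast]
  -- Without singletons, each moment is at most a power of the `L^n` norm, and the exponents sum to
  -- `n`. A singleton brings in the factor `E X = 0`.
  split_ifs with hπ
  · refine mul_le_mul_of_nonneg_left ?_ (by positivity)
    rw [Finset.abs_prod]
    calc ∏ B ∈ π.parts, |moment X B.card P|
        ≤ ∏ B ∈ π.parts, ((∫ ω, |X ω| ^ n ∂P) ^ (1 / n : ℝ)) ^ B.card := by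
          refine Finset.prod_le_prod (fun _ _ => abs_nonneg _) fun B hB => ?_
          refine le_trans ?_ (integral_abs_pow_le hX (by simpa using B.card_le_univ)
            (by have := hπ B hB; omega))
          rw [moment_def]
          refine (abs_integral_le_integral_abs).trans (le_of_eq ?_)
          simp
      _ = ∫ ω, |X ω| ^ n ∂P := by
          rw [Finset.prod_pow_eq_pow_sum, π.sum_card_parts, Finset.card_univ, Fintype.card_fin,
            ← Real.rpow_natCast, ← Real.rpow_mul hnn, one_div_mul_cancel (by positivity),
            Real.rpow_one]
  · push Not at hπ
    obtain ⟨B, hB, hB2⟩ := hπ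
    have hcard : B.card = 1 := by
      have := (π.nonempty_of_mem_parts hB).card_pos
      omega
    rw [Finset.prod_eq_zero hB (by rw [hcard, moment_one, h0])]
    simp

theorem cumulant_bound {n : ℕ} (hn : 2 ≤ n) (hX : AEMeasurable X P)
    (hXn : Integrable (fun ω => |X ω - ∫ ω', X ω' ∂P| ^ n) P) :
    Integrable (fun ω => |X ω| ^ n) P ∧
      |cumulant X P n| ≤ (centralCoeff n : ℝ) * ∫ ω, |X ω - ∫ ω', X ω' ∂P| ^ n ∂P := by
  -- A priori `c` could be the default value 0; since `X - c` lies in `L^n` for a constant `c`, so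
  -- does `X`, and `c` is the true mean.
  set c := ∫ ω', X ω' ∂P with hc
  have hY : MemLp (fun ω => X ω - c) n P :=
    memLp_of_integrable_abs_pow (by omega) (hX.sub_const c) hXn
  have hXL : MemLp X n P := by
    have := hY.add (memLp_const c)
    simpa [Pi.add_def] using this
  refine ⟨integrable_pow_of_memLp hXL.abs le_rfl, ?_⟩
  have hXi : Integrable X P := hXL.integrable (by exact_mod_cast (by omega : 1 ≤ n))
  have h0 : ∫ ω, (X ω - c) ∂P = 0 := by
    rw [integral_sub hXi (integrable_const c)]
    simp [hc]
  have := cumulant_add_const hn hY c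
  simp only [sub_add_cancel] at this
  rw [this]
  exact abs_cumulant_le_of_integral_eq_zero (by omega) hY h0

end moments

/-! ### The generating function of the coefficients -/

/-- The Taylor series at the origin of a complex function, as a formal power series. -/
noncomputable def taylorPowerSeries (f : ℂ → ℂ) : PowerSeries ℂ :=
  PowerSeries.mk fun n => iteratedDeriv n f 0 / n !

theorem coeff_taylorPowerSeries (f : ℂ → ℂ) (n : ℕ) :
    PowerSeries.coeff n (taylorPowerSeries f) = iteratedDeriv n f 0 / n ! :=
  PowerSeries.coeff_mk _ _

theorem taylorPowerSeries_mul {f g : ℂ → ℂ} (hf : AnalyticAt ℂ f 0) (hg : AnalyticAt ℂ g 0) :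
    taylorPowerSeries (f * g) = taylorPowerSeries f * taylorPowerSeries g := by
  ext n
  rw [coeff_taylorPowerSeries, PowerSeries.coeff_mul,
    iteratedDeriv_mul hf.contDiffAt hg.contDiffAt,
    Finset.Nat.sum_antidiagonal_eq_sum_range_succ_mk, Finset.sum_div]
  refine Finset.sum_congr rfl fun k hk => ?_
  have hk' : k ≤ n := by simpa [Nat.lt_succ_iff] using hk
  have h1 : (n ! : ℂ) ≠ 0 := by exact_mod_cast n.factorial_ne_zero
  have h2 : (k ! : ℂ) ≠ 0 := by exact_mod_cast k.factorial_ne_zero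
  have h3 : ((n - k)! : ℂ) ≠ 0 := by exact_mod_cast (n - k).factorial_ne_zero
  rw [coeff_taylorPowerSeries, coeff_taylorPowerSeries, Nat.cast_choose ℂ hk']
  field_simp

theorem derivative_taylorPowerSeries (f : ℂ → ℂ) :
    PowerSeries.derivative ℂ (taylorPowerSeries f) = taylorPowerSeries (deriv f) := by
  ext n
  have h1 : (n ! : ℂ) ≠ 0 := by exact_mod_cast n.factorial_ne_zero
  have h2 : (n + 1 : ℂ) ≠ 0 := by exact_mod_cast n.succ_ne_zero
  rw [PowerSeries.coeff_derivative, coeff_taylorPowerSeries, coeff_taylorPowerSeries,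
    iteratedDeriv_succ', Nat.factorial_succ]
  push_cast
  field_simp

theorem taylorPowerSeries_sub_const (a : ℂ) :
    taylorPowerSeries (fun z => z - a) = PowerSeries.X - PowerSeries.C a := by
  ext n
  rw [coeff_taylorPowerSeries]
  have hd : deriv (fun z : ℂ => z - a) = fun _ => 1 := by
    funext z
    simp
  rcases n with _ | n
  · simp
  · rw [iteratedDeriv_succ', hd]
    rcases n with _ | n
    · simp
    · simp [PowerSeries.coeff_X, iteratedDeriv_const]

theorem deriv_two_add_sub_exp :
    deriv (fun z : ℂ => 2 + z - Complex.exp z) = fun z => 1 - Complex.exp z := by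
  funext z
  exact (((hasDerivAt_id z).const_add 2).sub (Complex.hasDerivAt_exp z)).deriv

theorem iteratedDeriv_two_add_sub_exp (k : ℕ) :
    iteratedDeriv (k + 2) (fun z : ℂ => 2 + z - Complex.exp z) 0 = -1 := by
  have h : deriv (fun z : ℂ => 1 - Complex.exp z) = fun z => - Complex.exp z := by
    funext z
    exact ((Complex.hasDerivAt_exp z).const_sub 1).deriv
  rw [iteratedDeriv_succ', iteratedDeriv_succ', deriv_two_add_sub_exp, h, iteratedDeriv_fun_neg,
    iteratedDeriv_eq_iterate, Complex.iter_deriv_exp, Complex.exp_zero]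

/-- The logarithmic derivative of `2 + z - exp z` generates the numbers `-centralCoeff (n + 1)`. -/
theorem centralCoeff_succ_eq_coeff (n : ℕ) :
    (centralCoeff (n + 1) : ℂ) = -(n ! * PowerSeries.coeff n
      ((taylorPowerSeries fun z => 2 + z - Complex.exp z)⁻¹ *
        PowerSeries.derivative ℂ (taylorPowerSeries fun z => 2 + z - Complex.exp z))) := by
  set U := taylorPowerSeries fun z => 2 + z - Complex.exp z with hU
  have hU0 : PowerSeries.constantCoeff U = 1 := by
    rw [← PowerSeries.coeff_zero_eq_constantCoeff_apply, hU, coeff_taylorPowerSeries]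
    norm_num
  rw [← PowerSeries.sum_finpartition_eq_logDeriv U hU0, centralCoeff, ← Finset.sum_neg_distrib,
    Nat.cast_sum, Finset.sum_filter]
  refine Finset.sum_congr rfl fun π _ => ?_
  have hcoeff : ∀ k, (k ! * PowerSeries.coeff k U : ℂ) =
      iteratedDeriv k (fun z => 2 + z - Complex.exp z) 0 := fun k => by
    rw [hU, coeff_taylorPowerSeries, mul_div_cancel₀]
    exact_mod_cast k.factorial_ne_zero
  simp only [hcoeff]
  split_ifs with hπ
  -- The sign `(-1)^|π|` of the product against `(-1)^(|π|-1)` leaves a single minus sign for every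
  -- partition.
  · have : ∏ B ∈ π.parts, iteratedDeriv B.card (fun z : ℂ => 2 + z - Complex.exp z) 0 =
        (-1) ^ π.parts.card := by
      rw [← Finset.prod_const]
      refine Finset.prod_congr rfl fun B hB => ?_
      obtain ⟨k, hk⟩ := Nat.exists_eq_add_of_le' (hπ B hB)
      rw [hk, iteratedDeriv_two_add_sub_exp]
    rw [this]
    have hpos : 0 < π.parts.card := by
      rw [Finset.card_pos]
      exact π.parts_nonempty (by simpa using Finset.univ_nonempty.ne_empty)
    obtain ⟨k, hk⟩ := Nat.exists_eq_add_of_le' hpos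
    have hsq : ((-1 : ℂ) ^ k) * (-1) ^ k = 1 := by
      rw [← mul_pow]; norm_num
    rw [hk, Nat.add_sub_cancel]
    linear_combination (-(k ! : ℂ)) * hsq
  · push Not at hπ
    obtain ⟨B, hB, hB2⟩ := hπ
    have hcard : B.card = 1 := by
      have := (π.nonempty_of_mem_parts hB).card_pos
      omega
    rw [Finset.prod_eq_zero hB]
    · simp
    · rw [hcard, iteratedDeriv_one, deriv_two_add_sub_exp]
      simp

/-! ### The dominant pole and the asymptotics -/

/-- In the closed disc of radius `ρ`, the equation `exp z = 2 + z` has only the solution `ρ`. -/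
theorem eq_of_cexp_eq_two_add {ρ : ℝ} (hρ : 0 < ρ) (hexp : Real.exp ρ = 2 + ρ) {z : ℂ}
    (hz : ‖z‖ ≤ ρ) (hzexp : Complex.exp z = 2 + z) : z = ρ := by
  have h1 : HasSum (fun k : ℕ => ρ ^ k / k !) (2 + ρ) := by
    rw [← hexp, Real.exp_eq_exp_ℝ]
    exact NormedSpace.expSeries_div_hasSum_exp ρ
  have h2 : HasSum (fun k : ℕ => (z ^ k / k ! : ℂ).re) (2 + z.re) := by
    have : HasSum (fun k : ℕ => (z ^ k / k ! : ℂ)) (2 + z) := by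
      rw [← hzexp, Complex.exp_eq_exp_ℂ]
      exact NormedSpace.expSeries_div_hasSum_exp z
    simpa using Complex.hasSum_re this
  have h3 := h1.sub h2
  have hre : ∀ k : ℕ, (z ^ k / k ! : ℂ).re = (z ^ k).re / k ! := fun k => by
    rw [← Complex.ofReal_natCast, Complex.div_ofReal_re]
  simp only [hre, ← sub_div] at h3
  have hle : ∀ k : ℕ, (z ^ k).re ≤ ρ ^ k := fun k => by
    refine (Complex.re_le_norm _).trans ?_
    rw [norm_pow]
    exact pow_le_pow_left₀ (norm_nonneg _) hz k
  have hnn : ∀ k : ℕ, 0 ≤ (ρ ^ k - (z ^ k).re) / k ! := fun k =>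
    div_nonneg (sub_nonneg.2 (hle k)) (by positivity)
  -- The nonnegative terms sum to `ρ - z.re`, which is already the term `k = 1`; all others must
  -- vanish. Then `k = 2` makes `z` real and `k = 3` makes it positive.
  have h4 : ∀ k : ℕ, k ≠ 1 → ρ ^ k ≤ (z ^ k).re := by
    intro k hk
    have := sum_le_hasSum {1, k} (fun i _ => hnn i) h3
    rw [Finset.sum_pair hk.symm] at this
    simp only [pow_one, Nat.factorial_one, Nat.cast_one, div_one] at this
    have h5 : (ρ ^ k - (z ^ k).re) / k ! ≤ 0 := by linarith
    rw [div_le_iff₀ (by positivity)] at h5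
    linarith
  have e2 := h4 2 (by norm_num)
  have e3 := h4 3 (by norm_num)
  have hn : z.re ^ 2 + z.im ^ 2 ≤ ρ ^ 2 := by
    have := pow_le_pow_left₀ (norm_nonneg z) hz 2
    rw [← Complex.normSq_eq_norm_sq, Complex.normSq_apply] at this
    linarith
  simp only [pow_succ, pow_zero, one_mul, Complex.mul_re, Complex.mul_im] at e2 e3
  have him : z.im = 0 := by
    have : z.im ^ 2 ≤ 0 := by nlinarith
    exact pow_eq_zero_iff (two_ne_zero) |>.1 (le_antisymm this (sq_nonneg _))
  rw [him] at e2 e3 hn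
  have hpos : 0 < z.re := by
    by_contra hneg
    have : 0 < ρ * ρ * ρ := by positivity
    have : z.re * z.re * z.re ≤ 0 :=
      mul_nonpos_of_nonneg_of_nonpos (mul_self_nonneg _) (not_lt.1 hneg)
    nlinarith
  have hre : z.re = ρ := by
    have : z.re ^ 2 = ρ ^ 2 := by nlinarith
    exact (pow_left_inj₀ hpos.le hρ.le two_ne_zero).1 this
  apply Complex.ext
  · simpa using hre
  · simpa using him

theorem tendsto_centralCoeff {ρ : ℝ} (hρ : 0 < ρ) (hexp : Real.exp ρ = 2 + ρ) :
    Filter.Tendsto (fun n : ℕ => (centralCoeff (n + 1) : ℝ) / n ! * ρ ^ (n + 1)) Filter.atTop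
      (nhds 1) := by
  set u : ℂ → ℂ := fun z => 2 + z - Complex.exp z with hu
  set v : ℂ → ℂ := fun z => 1 - Complex.exp z with hv
  set δ : ℂ → ℂ := dslope u ρ with hδ
  have hexpC : Complex.exp ρ = 2 + ρ := by
    rw [← Complex.ofReal_exp, hexp]; push_cast; rfl
  have hud : Differentiable ℂ u := by fun_prop
  have hvd : Differentiable ℂ v := by fun_prop
  have hδd : Differentiable ℂ δ := by
    rw [← differentiableOn_univ] at hud ⊢
    exact (Complex.differentiableOn_dslope Filter.univ_mem).2 hud
  have huρ : u ρ = 0 := by simp [hu, hexpC]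
  have hfac : u = (fun z : ℂ => z - (ρ : ℂ)) * δ := by
    funext z
    have := sub_smul_dslope u (ρ : ℂ) z
    rw [huρ, sub_zero] at this
    exact this.symm
  have hδρ : δ ρ = v ρ := by
    rw [hδ, dslope_same, hu, deriv_two_add_sub_exp]
  have hvρ : v ρ ≠ 0 := by
    have : v ρ = ((-1 - ρ : ℝ) : ℂ) := by
      simp only [hv, hexpC]; push_cast; ring
    rw [this]
    exact_mod_cast (by linarith : -1 - ρ < 0).ne
  have hne : ∀ z : ℂ, ‖z‖ ≤ ρ → δ z ≠ 0 := by
    intro z hz h0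
    by_cases hzρ : z = ρ
    · rw [hzρ, hδρ] at h0
      exact hvρ h0
    · refine hzρ (eq_of_cexp_eq_two_add hρ hexp hz ?_)
      have : u z = 0 := by rw [hfac, Pi.mul_apply, h0, mul_zero]
      exact (sub_eq_zero.1 this).symm
  -- Compactness yields a larger disc on which `δ = u / (z - ρ)` has no zero, so `ρ` lies inside the
  -- disc of convergence of `G`.
  obtain ⟨ε, hε, hsub⟩ := (isCompact_closedBall (0 : ℂ) ρ).exists_thickening_subset_open
    (isOpen_compl_singleton.preimage hδd.continuous : IsOpen (δ ⁻¹' {0}ᶜ))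
    (fun z hz => hne z (by simpa using hz))
  rw [thickening_closedBall hε hρ.le] at hsub
  set G : ℂ → ℂ := fun z => v z / δ z with hG
  have hGd : DifferentiableOn ℂ G (Metric.ball 0 (ε + ρ)) :=
    hvd.differentiableOn.div hδd.differentiableOn fun z hz => hsub hz
  have hsum := Complex.hasSum_taylorSeries_on_ball hGd
    (show (ρ : ℂ) ∈ Metric.ball (0 : ℂ) (ε + ρ) by simp [abs_of_pos hρ, hε])
  have hGρ : G ρ = 1 := by
    simp only [hG, hδρ]
    exact div_self hvρ
  have hGan : AnalyticAt ℂ G 0 :=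
    hGd.analyticAt (Metric.ball_mem_nhds _ (by positivity))
  have hGδ : taylorPowerSeries v = taylorPowerSeries G * taylorPowerSeries δ := by
    rw [← taylorPowerSeries_mul hGan (hδd.analyticAt 0)]
    ext n
    rw [coeff_taylorPowerSeries, coeff_taylorPowerSeries]
    congr 1
    refine Filter.EventuallyEq.iteratedDeriv_eq n ?_
    filter_upwards [Metric.ball_mem_nhds (0 : ℂ) (show 0 < ε + ρ by positivity)] with z hz
    exact (div_mul_cancel₀ _ (hsub hz)).symm
  have hUδ : taylorPowerSeries u = (PowerSeries.X - PowerSeries.C (ρ : ℂ)) *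
      taylorPowerSeries δ := by
    rw [← taylorPowerSeries_sub_const, ← taylorPowerSeries_mul (by fun_prop) (hδd.analyticAt 0),
      ← hfac]
  have hU0 : PowerSeries.constantCoeff (taylorPowerSeries u) ≠ 0 := by
    rw [← PowerSeries.coeff_zero_eq_constantCoeff_apply, coeff_taylorPowerSeries]
    simp only [hu, iteratedDeriv_zero, Complex.exp_zero]
    norm_num
  set A := (taylorPowerSeries u)⁻¹ * PowerSeries.derivative ℂ (taylorPowerSeries u) with hA
  have hUA : taylorPowerSeries u * A = taylorPowerSeries v := by
    rw [hA, ← mul_assoc, PowerSeries.mul_inv_cancel _ hU0, one_mul, derivative_taylorPowerSeries,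
      hu, deriv_two_add_sub_exp]
  have hδ0 : taylorPowerSeries δ ≠ 0 := by
    intro h
    rw [hUδ, h, mul_zero, map_zero] at hU0
    exact hU0 rfl
  have hlin : (PowerSeries.X - PowerSeries.C (ρ : ℂ)) * A = taylorPowerSeries G := by
    apply mul_right_cancel₀ hδ0
    rw [← hGδ, ← hUA, hUδ]
    ring
  -- Multiplication by `X - ρ` makes the weighted coefficients of `A` telescope.
  have hpart : ∀ n : ℕ, -(PowerSeries.coeff n A) * (ρ : ℂ) ^ (n + 1) =
      ∑ k ∈ Finset.range (n + 1), PowerSeries.coeff k (taylorPowerSeries G) * (ρ : ℂ) ^ k := by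
    intro n
    rw [← hlin]
    induction n with
    | zero => simp [sub_mul]; ring
    | succ n ih =>
      rw [Finset.sum_range_succ, ← ih, sub_mul, map_sub, PowerSeries.coeff_succ_X_mul,
        PowerSeries.coeff_C_mul]
      ring
  have hlim : Filter.Tendsto (fun n : ℕ => ∑ k ∈ Finset.range (n + 1),
      PowerSeries.coeff k (taylorPowerSeries G) * (ρ : ℂ) ^ k) Filter.atTop (nhds 1) := by
    rw [← hGρ]
    refine (Filter.tendsto_add_atTop_iff_nat 1).2 (HasSum.tendsto_sum_nat ?_)
    have hterm : (fun k : ℕ => PowerSeries.coeff k (taylorPowerSeries G) * (ρ : ℂ) ^ k) =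
        fun k => (k ! : ℂ)⁻¹ • ((ρ : ℂ) - 0) ^ k • iteratedDeriv k G 0 := by
      funext k
      rw [coeff_taylorPowerSeries, sub_zero, smul_eq_mul, smul_eq_mul]
      ring
    rw [hterm]
    exact hsum
  simp only [← hpart] at hlim
  have hre := (Complex.continuous_re.tendsto _).comp hlim
  rw [Complex.one_re] at hre
  refine hre.congr fun n => ?_
  have hn : (n ! : ℂ) ≠ 0 := by exact_mod_cast n.factorial_ne_zero
  have : -(PowerSeries.coeff n A) * (ρ : ℂ) ^ (n + 1) =
      (((centralCoeff (n + 1) : ℝ) / n ! * ρ ^ (n + 1) : ℝ) : ℂ) := by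
    push_cast
    rw [centralCoeff_succ_eq_coeff, ← hu, ← hA]
    field_simp
  rw [Function.comp_apply, this, Complex.ofReal_re]

/-! ### Location and uniqueness of the root -/

theorem exp_sub_lt_exp_sub {x y : ℝ} (hx : 0 ≤ x) (hxy : x < y) :
    Real.exp x - x < Real.exp y - y := by
  have h1 : Real.exp y = Real.exp x * Real.exp (y - x) := by
    rw [← Real.exp_add]; congr 1; ring
  have h2 : y - x + 1 < Real.exp (y - x) := Real.add_one_lt_exp (by linarith)
  have h3 : 1 ≤ Real.exp x := Real.one_le_exp hx
  nlinarith

theorem exp_lt_two_add : Real.exp 1.1455 < 2 + 1.1455 := by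
  have h1 : Real.exp 1.1455 = Real.exp 1 * Real.exp 0.1455 := by
    rw [← Real.exp_add]; norm_num
  have h2 := Real.exp_bound' (x := 0.1455) (by norm_num) (by norm_num) (n := 4) (by norm_num)
  -- Any bound below `3.1455 / e ≈ 1.1572` suffices.
  have h3 : Real.exp 0.1455 < 1.15665 := by
    refine h2.trans_lt ?_
    norm_num [Finset.sum_range_succ, Nat.factorial]
  have h4 := Real.exp_one_lt_d9
  have h5 := Real.exp_pos 0.1455
  rw [h1]
  nlinarith

theorem two_add_lt_exp : 2 + 1.1465 < Real.exp 1.1465 := by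
  have h1 : Real.exp 1.1465 = Real.exp 1 * Real.exp 0.1465 := by
    rw [← Real.exp_add]; norm_num
  have h2 := Real.sum_le_exp_of_nonneg (x := 0.1465) (by norm_num) 4
  have h3 : 1.15775 < Real.exp 0.1465 := by
    refine lt_of_lt_of_le ?_ h2
    norm_num [Finset.sum_range_succ, Nat.factorial]
  have h4 := Real.exp_one_gt_d9
  rw [h1]
  nlinarith

theorem exists_exp_eq_two_add :
    ∃ ρ ∈ Set.Ioo (1.1455 : ℝ) 1.1465, Real.exp ρ = 2 + ρ := by
  have hc : ContinuousOn (fun x : ℝ => Real.exp x - (2 + x)) (Set.Icc 1.1455 1.1465) := by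
    fun_prop
  obtain ⟨ρ, hρ, h⟩ := intermediate_value_Ioo (by norm_num) hc
    (show (0 : ℝ) ∈ Set.Ioo _ _ from
      ⟨by linarith [exp_lt_two_add], by linarith [two_add_lt_exp]⟩)
  exact ⟨ρ, hρ, sub_eq_zero.1 h⟩

theorem isEquivalent_centralCoeff {ρ : ℝ} (hρ : 0 < ρ) (hexp : Real.exp ρ = 2 + ρ) :
    Asymptotics.IsEquivalent Filter.atTop (fun n : ℕ => (centralCoeff n : ℝ))
      (fun n : ℕ => ((n - 1)! : ℝ) / ρ ^ n) := by
  -- Shifting the index by one removes the truncated subtraction in `(n - 1)!`.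
  rw [Asymptotics.isEquivalent_iff_tendsto_one (Filter.Eventually.of_forall fun n => by positivity),
    ← Filter.tendsto_add_atTop_iff_nat 1]
  refine (tendsto_centralCoeff hρ hexp).congr fun n => ?_
  simp only [Pi.div_apply, Nat.add_sub_cancel]
  field_simp

theorem theorem3p2 :
    (∀ (Ω : Type*) [MeasurableSpace Ω] (P : MeasureTheory.Measure Ω)
        [MeasureTheory.IsProbabilityMeasure P] (X : Ω → ℝ) (n : ℕ),
        2 ≤ n → AEMeasurable X P →
        MeasureTheory.Integrable (fun ω => |X ω - ∫ ω', X ω' ∂P| ^ n) P →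
        MeasureTheory.Integrable (fun ω => |X ω| ^ n) P ∧
        |cumulant X P n| ≤ (centralCoeff n : ℝ) * ∫ ω, |X ω - ∫ ω', X ω' ∂P| ^ n ∂P) ∧
    ∃ ρ : ℝ, 0 < ρ ∧ Real.exp ρ = 2 + ρ ∧
      (∀ x : ℝ, 0 < x → Real.exp x = 2 + x → x = ρ) ∧
      |ρ - 1.146| < 0.0005 ∧
      Asymptotics.IsEquivalent Filter.atTop (fun n : ℕ => (centralCoeff n : ℝ))
        (fun n : ℕ => ((n - 1)! : ℝ) / ρ ^ n) := by
  refine ⟨fun Ω _ P _ X n hn hX hXn => cumulant_bound hn hX hXn, ?_⟩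
  obtain ⟨ρ, ⟨hlo, hhi⟩, hexp⟩ := exists_exp_eq_two_add
  have hρ : 0 < ρ := by linarith
  refine ⟨ρ, hρ, hexp, fun x hx hxe => ?_, ?_, isEquivalent_centralCoeff hρ hexp⟩
  · rcases lt_trichotomy x ρ with h | h | h
    · linarith [exp_sub_lt_exp_sub hx.le h]
    · exact h
    · linarith [exp_sub_lt_exp_sub hρ.le h]
  · rw [abs_lt]
    constructor <;> linarith
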